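/- Let $T\ge 0$, let $N_1,\dots,N_T$ be pairwise disjoint finite sets of items and let $N=N_1\cup\dots\cup N_T$; items of $N_t$ can be allocated only to agent $t$. Let $M=(N,\mathcal I)$ be a matroid and $G=(N,E)$ a simple undirected graph. An allocation $(Y_1,\dots,Y_T)$ with $Y_t\subseteq N_t$ is feasible if $Y_1\cup\dots\cup Y_T$ is independent in $M$ (it lies in $\mathcal I$) and independent in $G$ (no two of its items are adjacent). Put $d_1(M)=0$ if $\mathcal I=2^N$ and $d_1(M)=1$ otherwise, and $$d_2(G)=\max_{t\in\{1,\dots,T\},\ i\in N_t}\alpha\Big(G\big[\{i'\in N_{t'}: t'<t,\ \{i,i'\}\in E\}\big]\Big),$$ where $G[\cdot]$ is the induced subgraph and $\alpha$ is the maximum size of an independent set (the maximum is $0$ if $N=\emptyset$). For each agent $t$, a random valuation function $v_t:2^{N_t}\to\mathbb R$ has a known distribution with finite support: $v_t=v_t^k$ with probability $p_t^k$, $k=1,\dots,K$, where $p_t^k\ge0$ and $\sum_k p_t^k=1$. Suppose that every realization $v_t^k$ (with $p_t^k>0$) is XOS, i.e. $v_t^k(S)=\max_{\ell\in\{1,\dots,L\}}w_\ell(S)$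 for all $S\subseteq N_t$, for some $L\ge 1$ and additive functions $w_1,\dots,w_L:2^{N_t}\to\mathbb R$ (additive: $w(S)+w(S')=w(S\cup S')$ for disjoint $S,S'$). An online algorithm sees the valuation functions $v_1,\dots,v_T$ one after another, in this order, and chooses $Y_t$ as a function of $v_1,\dots,v_t$ only, so that the final allocation is always feasible; it may depend on the sets $N_t$, on $M$, $G$ and on the distributions. Its expected welfare is $\mathbb E\big[\sum_t v_t(Y_t)\big]$ when $v_1,\dots,v_T$ are independent. Let $$\mathrm{OPT}=\sup_{D}\ \mathbb E_{(v_1,\dots,v_T)\sim D}\Big[\max_{(Y_1,\dots,Y_T)\text{ feasible}}\ \sum_{t=1}^T v_t(Y_t)\Big],$$ where $D$ ranges over all joint distributions of $(v_1,\dots,v_T)$ with the given marginals; that is, $\mathrm{OPT}$ is the expected welfare of a prophet who can choose the correlation between the valuation functions and sees all their realizations beforehand. Then there is a (deterministic) online algorithm whose expected welfare is at least $$\frac{1}{(d_1(M)+1)(d_2(G)+1)}\cdot\mathrm{OPT}.$$ -/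

import Mathlib

/-- A valuation function on a set `α` of items: a real value for every (finite) set of items. -/
abbrev SetValuation (α : Type*) := Finset α → ℝ

/-- `w` is additive: `w S + w S' = w (S ∪ S')` for all disjoint `S`, `S'`. -/
def IsAdditive {α : Type*} (w : SetValuation α) : Prop :=
  ∀ (S S' : Finset α) (h : Disjoint S S'), w S + w S' = w (S.disjUnion S' h)

/-- `v` is XOS (fractionally subadditive): it is the pointwise maximum of a finite collection
`w 1, …, w L` of additive functions. (The maximum is attained, so `L ≥ 1`.) -/
def IsXOS {α : Type*} (v : SetValuation α) : Prop :=
  ∃ (L : ℕ) (w : Fin L → SetValuation α), (∀ l, IsAdditive (w l)) ∧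
    ∀ S, IsGreatest (Set.range fun l => w l S) (v S)

/-- `d₁(M) = 0` if every subset of the ground set is independent, and `d₁(M) = 1` otherwise. -/
noncomputable def d1 {α : Type*} (M : Matroid α) : ℕ :=
  open Classical in if ∀ S ⊆ M.E, M.Indep S then 0 else 1

section Auction

variable {T : ℕ} {N : Fin T → Type*}

/-- The set of items of earlier agents that are adjacent to the item `i`
(`i.1` is the agent who may receive `i`). -/
def earlierNeighbors (G : SimpleGraph (Σ t, N t)) (i : Σ t, N t) : Set (Σ t, N t) :=
  {i' | G.Adj i i' ∧ i'.1 < i.1}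

/-- `d₂(G)`: the maximum, over all items `i`, of the independence number of the subgraph of `G`
induced by the neighbours of `i` that belong to earlier agents (`0` if there is no item). -/
noncomputable def d2 [∀ t, Fintype (N t)] (G : SimpleGraph (Σ t, N t)) : ℕ :=
  Finset.univ.sup fun i => (G.induce (earlierNeighbors G i)).indepNum

/-- The union `Y₁ ∪ … ∪ Y_T` of the sets of items in an allocation. -/
def allocated (Y : ∀ t, Finset (N t)) : Finset (Σ t, N t) :=
  Finset.univ.sigma Y

/-- An allocation is feasible if the set of all allocated items is independent both in the
matroid and in the graph. -/
def Feasible (M : Matroid (Σ t, N t)) (G : SimpleGraph (Σ t, N t))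
    (Y : ∀ t, Finset (N t)) : Prop :=
  M.Indep (allocated Y : Set (Σ t, N t)) ∧ G.IsIndepSet (allocated Y : Set (Σ t, N t))

/-- The welfare `∑ₜ vₜ(Yₜ)`. -/
def welfare (v : ∀ t, SetValuation (N t)) (Y : ∀ t, Finset (N t)) : ℝ :=
  ∑ t, v t (Y t)

theorem feasible_empty (M : Matroid (Σ t, N t)) (G : SimpleGraph (Σ t, N t)) :
    Feasible M G (fun _ => ∅) := by
  have h : allocated (fun t => (∅ : Finset (N t))) = ∅ := by
    ext i; simp [allocated]
  simp [Feasible, h, SimpleGraph.IsIndepSet]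

/-- The maximum welfare of a feasible allocation for a known profile of valuation functions. -/
noncomputable def maxWelfare [∀ t, Fintype (N t)] (M : Matroid (Σ t, N t))
    (G : SimpleGraph (Σ t, N t)) (v : ∀ t, SetValuation (N t)) : ℝ :=
  open Classical in
  (Finset.univ.filter (Feasible M G)).sup' ⟨fun _ => ∅, by simp [feasible_empty]⟩ (welfare v)

/-- A (deterministic) online algorithm. It maps a profile of valuation functions to an allocation
that is feasible, and the set given to agent `t` depends only on the valuation functions of the
agents up to and including `t`. -/
structure OnlineAlgorithm (M : Matroid (Σ t, N t)) (G : SimpleGraph (Σ t, N t)) where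
  alloc : (∀ t, SetValuation (N t)) → ∀ t, Finset (N t)
  feasible : ∀ v, Feasible M G (alloc v)
  nonanticipating : ∀ v v' t, (∀ s ≤ t, v s = v' s) → alloc v t = alloc v' t

/-- The profile of valuation functions when agent `t` realizes to her `k t`-th function. -/
def profile {K : ℕ} (v : ∀ t, Fin K → SetValuation (N t)) (k : Fin T → Fin K) :
    ∀ t, SetValuation (N t) :=
  fun t => v t (k t)

/-- The expected welfare of an online algorithm, when the valuation functions of the agents realize
independently, and that of agent `t` is `v t k` with probability `p t k`. -/
noncomputable def expectedWelfare {K : ℕ} {M : Matroid (Σ t, N t)} {G : SimpleGraph (Σ t, N t)}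
    (A : OnlineAlgorithm M G) (p : Fin T → Fin K → ℝ) (v : ∀ t, Fin K → SetValuation (N t)) : ℝ :=
  ∑ k : Fin T → Fin K, (∏ t, p t (k t)) * welfare (profile v k) (A.alloc (profile v k))

/-- `q` is a joint distribution of the realizations of all agents with marginals `p`. -/
structure IsCoupling {K : ℕ} (p : Fin T → Fin K → ℝ) (q : (Fin T → Fin K) → ℝ) : Prop where
  nonneg : ∀ k, 0 ≤ q k
  sum_eq_one : ∑ k, q k = 1
  marginal : ∀ t j, ∑ k with k t = j, q k = p t j

/-- The expected welfare of the prophet under the joint distribution `q`: he sees the realizations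
of all valuation functions and picks a feasible allocation of maximum welfare. -/
noncomputable def prophetWelfare [∀ t, Fintype (N t)] {K : ℕ} (M : Matroid (Σ t, N t))
    (G : SimpleGraph (Σ t, N t)) (v : ∀ t, Fin K → SetValuation (N t))
    (q : (Fin T → Fin K) → ℝ) : ℝ :=
  ∑ k, q k * maxWelfare M G (profile v k)

/-- `OPT`: the supremum of the prophet's expected welfare over all joint distributions with the
given marginals. -/
noncomputable def OPT [∀ t, Fintype (N t)] {K : ℕ} (M : Matroid (Σ t, N t))
    (G : SimpleGraph (Σ t, N t)) (p : Fin T → Fin K → ℝ) (v : ∀ t, Fin K → SetValuation (N t)) : ℝ :=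
  sSup {w | ∃ q, IsCoupling p q ∧ w = prophetWelfare M G v q}

/-- The independent product is a coupling. -/
theorem isCoupling_prod {K : ℕ} (p : Fin T → Fin K → ℝ) (hp0 : ∀ t k, 0 ≤ p t k)
    (hp1 : ∀ t, ∑ k, p t k = 1) : IsCoupling p (fun k => ∏ t, p t (k t)) where
  nonneg k := Finset.prod_nonneg fun t _ => hp0 t (k t)
  sum_eq_one := by
    have h := Finset.prod_univ_sum (fun _ => Finset.univ) p
    rw [Fintype.piFinset_univ] at h
    rw [← h]
    simp [hp1]
  marginal t j := by
    have h := Finset.prod_univ_sum (fun s => if s = t then {j} else Finset.univ) p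
    have h2 : (Fintype.piFinset fun s => if s = t then ({j} : Finset (Fin K)) else Finset.univ)
        = Finset.univ.filter fun k => k t = j := by
      ext k
      simp only [Fintype.mem_piFinset, Finset.mem_filter, Finset.mem_univ, true_and]
      constructor
      · intro hk; simpa using hk t
      · rintro hk s
        by_cases hs : s = t
        · subst hs; simp [hk]
        · simp [hs]
    rw [h2] at h
    rw [← h, Finset.prod_eq_single t]
    · simp
    · intro s _ hs; simp [hs, hp1]
    · simp

/-- The supremum that defines `OPT` is over a set that is bounded above. -/
theorem bddAbove_prophetWelfare [∀ t, Fintype (N t)] {K : ℕ} (M : Matroid (Σ t, N t))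
    (G : SimpleGraph (Σ t, N t)) (p : Fin T → Fin K → ℝ) (v : ∀ t, Fin K → SetValuation (N t)) :
    BddAbove {w | ∃ q, IsCoupling p q ∧ w = prophetWelfare M G v q} := by
  refine ⟨∑ k, |maxWelfare M G (profile v k)|, ?_⟩
  rintro w ⟨q, hq, rfl⟩
  refine Finset.sum_le_sum fun k _ => ?_
  have h1 : q k ≤ 1 := hq.sum_eq_one ▸
    Finset.single_le_sum (fun k _ => hq.nonneg k) (Finset.mem_univ k)
  calc q k * maxWelfare M G (profile v k) ≤ q k * |maxWelfare M G (profile v k)| :=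
        mul_le_mul_of_nonneg_left (le_abs_self _) (hq.nonneg k)
    _ ≤ 1 * |maxWelfare M G (profile v k)| := mul_le_mul_of_nonneg_right h1 (abs_nonneg _)
    _ = _ := one_mul _

/-- No joint distribution with the given marginals gives a prophet more than `OPT`. -/
theorem prophetWelfare_le_OPT [∀ t, Fintype (N t)] {K : ℕ} (M : Matroid (Σ t, N t))
    (G : SimpleGraph (Σ t, N t)) (p : Fin T → Fin K → ℝ) (v : ∀ t, Fin K → SetValuation (N t))
    (q : (Fin T → Fin K) → ℝ) (hq : IsCoupling p q) : prophetWelfare M G v q ≤ OPT M G p v :=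
  le_csSup (bddAbove_prophetWelfare M G p v) ⟨q, hq, rfl⟩

end Auction

/-!
The algorithm follows an optimal policy of the online dynamic program; its value is bounded from
below by comparing it with an offline solution in two steps.

*The graph.* Every item is charged a compensation for its later neighbours, namely the sum of
their prices, where the price of an item is its expected weight in the offline solution net of its
own compensation. An item blocked by an earlier choice has then been paid for. Since at most `d₂`
earlier neighbours of an item belong to an offline solution, the compensations amount to at most
`d₂` times the total price, so the prices retain a fraction `1 / (d₂ + 1)` of the offline weight.

*The matroid.* For the net weights only the matroid matters. If it is not free, cut the
weight `w` of the offline solution into layers `{w ≥ c}` and count each layer by its rank after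
contraction of the items taken so far: half of the expected result is a potential that the dynamic
program dominates, which costs a factor `2`.

Only the marginals enter: each agent may draw a fresh scenario from the coupling, conditioned on
her own valuation, and buy from her part of the corresponding offline solution.
-/

section MatroidRank

variable {α ι : Type*} (M : Matroid α)

/-- The rank of a finite set of elements of a matroid, as a real number, so that ranks can be
subtracted and averaged. -/
noncomputable def realRk (X : Finset α) : ℝ :=
  (M.eRk (X : Set α)).toNat

theorem eRk_coe_ne_top (X : Finset α) : M.eRk (X : Set α) ≠ ⊤ :=
  Matroid.eRk_ne_top_iff.2 (M.isRkFinite_of_finite X.finite_toSet)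

theorem realRk_nonneg (X : Finset α) : 0 ≤ realRk M X :=
  Nat.cast_nonneg _

theorem realRk_mono {X Y : Finset α} (h : X ⊆ Y) : realRk M X ≤ realRk M Y :=
  Nat.cast_le.2 <| ENat.toNat_le_toNat (M.eRk_mono (Finset.coe_subset.2 h)) (eRk_coe_ne_top M Y)

theorem realRk_le_card (X : Finset α) : realRk M X ≤ X.card := by
  have h := ENat.toNat_le_toNat (M.eRk_le_encard (X : Set α)) (by simp)
  rw [Set.encard_coe_eq_coe_finsetCard, ENat.toNat_natCast] at h
  exact Nat.cast_le.2 h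

variable {M} in
theorem realRk_eq_card {X : Finset α} (h : M.Indep (X : Set α)) : realRk M X = X.card := by
  simp [realRk, h.eRk_eq_encard]

variable [DecidableEq α]

theorem realRk_inter_add_realRk_union_le (X Y : Finset α) :
    realRk M (X ∩ Y) + realRk M (X ∪ Y) ≤ realRk M X + realRk M Y := by
  have h := M.eRk_inter_add_eRk_union_le (X : Set α) Y
  rw [← Finset.coe_inter, ← Finset.coe_union] at h
  have h' := ENat.toNat_le_toNat h (by simp)
  rw [ENat.toNat_add (eRk_coe_ne_top M _) (eRk_coe_ne_top M _),
    ENat.toNat_add (eRk_coe_ne_top M _) (eRk_coe_ne_top M _)] at h'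
  unfold realRk
  exact_mod_cast h'

theorem realRk_union_sub_le_card (X Y : Finset α) :
    realRk M (X ∪ Y) - realRk M X ≤ Y.card := by
  linarith [realRk_inter_add_realRk_union_le M X Y, realRk_le_card M Y, realRk_nonneg M (X ∩ Y)]

theorem realRk_union_sub_anti {Z Z' : Finset α} (h : Z ⊆ Z') (X : Finset α) :
    realRk M (Z' ∪ X) - realRk M Z' ≤ realRk M (Z ∪ X) - realRk M Z := by
  have hsub := realRk_inter_add_realRk_union_le M Z' (Z ∪ X)
  have hmono := realRk_mono M (Finset.subset_inter h (Finset.subset_union_left (s₂ := X)))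
  rw [← Finset.union_assoc, Finset.union_eq_left.2 h] at hsub
  linarith

theorem realRk_union_biUnion_sub_le (Z : Finset α) (s : Finset ι) (V : ι → Finset α) :
    realRk M (Z ∪ s.biUnion V) - realRk M Z ≤ ∑ t ∈ s, (realRk M (Z ∪ V t) - realRk M Z) := by
  classical
  induction s using Finset.induction_on with
  | empty => simp
  | insert a s ha ih =>
    have h := realRk_union_sub_anti M (Finset.subset_union_left (s₁ := Z) (s₂ := s.biUnion V)) (V a)
    rw [Finset.union_assoc, Finset.union_comm (s.biUnion V)] at h
    rw [Finset.sum_insert ha, Finset.biUnion_insert]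
    linarith

/-- The rank of `R` in the contraction of the matroid by `Y`. -/
noncomputable def contractRk (R Y : Finset α) : ℝ :=
  realRk M (R ∪ Y) - realRk M Y

variable {M} in
theorem contractRk_empty {R : Finset α} (hR : M.Indep (R : Set α)) :
    contractRk M R ∅ = R.card := by
  simp [contractRk, realRk, hR.eRk_eq_encard]

theorem contractRk_sub_contractRk_union_le (R V : Finset α) {Y A : Finset α} (hY : Y ⊆ A) :
    contractRk M R Y - contractRk M R (Y ∪ V) ≤
      V.card - (realRk M (R ∪ A ∪ V) - realRk M (R ∪ A)) := by
  have hcard := realRk_union_sub_le_card M Y V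
  have hanti := realRk_union_sub_anti M (Finset.union_subset_union_right (s := R) hY) V
  rw [contractRk, contractRk, ← Finset.union_assoc]
  linarith

variable {M} in
theorem sum_contractRk_sub_le [Fintype ι] [DecidableEq ι] (owner : α → ι) (R : Finset α)
    {A V : Finset α} {Y : ι → Finset α} (hAV : Disjoint A V)
    (hI : M.Indep (A ∪ V : Finset α)) (hY : ∀ t, Y t ⊆ A) :
    ∑ t, (contractRk M R (Y t) - contractRk M R (Y t ∪ {i ∈ V | owner i = t})) ≤
      contractRk M R A := by
  have hloss := Finset.sum_le_sum fun t (_ : t ∈ Finset.univ) =>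
    contractRk_sub_contractRk_union_le M R {i ∈ V | owner i = t} (hY t)
  have hcard : ∑ t, ((V.filter (owner · = t)).card : ℝ) = V.card := by
    exact_mod_cast (Finset.card_eq_sum_card_fiberwise fun i _ => Finset.mem_univ (owner i)).symm
  have hrk := realRk_union_biUnion_sub_le M (R ∪ A) Finset.univ fun t => {i ∈ V | owner i = t}
  rw [Finset.biUnion_filter_eq_of_maps_to fun i _ => Finset.mem_univ (owner i)] at hrk
  have hAVcard := realRk_eq_card hI
  rw [Finset.card_union_of_disjoint hAV, Nat.cast_add] at hAVcard
  have hA := realRk_eq_card (hI.subset (Finset.coe_subset.2 Finset.subset_union_left))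
  have hmono : realRk M (A ∪ V) ≤ realRk M (R ∪ A ∪ V) :=
    realRk_mono M (by rw [Finset.union_assoc]; exact Finset.subset_union_right)
  rw [Finset.sum_sub_distrib (f := fun t => ((V.filter (owner · = t)).card : ℝ)), hcard] at hloss
  rw [contractRk]
  linarith

variable {M} in
theorem exists_extension_card_eq_contractRk {A V R : Finset α} (hVR : V ⊆ R)
    (hAV : Disjoint A V) (hI : M.Indep (A ∪ V : Finset α)) :
    ∃ V', V ⊆ V' ∧ V' ⊆ R ∧ Disjoint A V' ∧ M.Indep (A ∪ V' : Finset α) ∧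
      (V'.card : ℝ) = contractRk M R A := by
  obtain ⟨B, hB, hsub⟩ := hI.subset_isBasis'_of_subset
    (Finset.coe_subset.2 (Finset.union_subset (Finset.subset_union_right (s₁ := R))
      (hVR.trans Finset.subset_union_left)))
  lift B to Finset α using (R ∪ A).finite_toSet.subset hB.subset
  obtain ⟨hAB, hVB⟩ := Finset.union_subset_iff.1 (Finset.coe_subset.1 hsub)
  refine ⟨B \ A, Finset.subset_sdiff.2 ⟨hVB, hAV.symm⟩,
    sdiff_le_iff'.2 (Finset.coe_subset.1 hB.subset),
    Finset.disjoint_sdiff, ?_, ?_⟩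
  · rw [Finset.union_sdiff_of_subset hAB]
    exact hB.indep
  · have hrk : realRk M (R ∪ A) = realRk M B := by rw [realRk, realRk, hB.eRk_eq_eRk]
    rw [contractRk, hrk, realRk_eq_card hB.indep,
      realRk_eq_card (hB.indep.subset (Finset.coe_subset.2 hAB)),
      Finset.card_sdiff_of_subset hAB, Nat.cast_sub (Finset.card_le_card hAB)]

end MatroidRank

section BalancedPotential

variable {α ι : Type*} [DecidableEq α] [Fintype ι] [DecidableEq ι] {M : Matroid α} {owner : α → ι}

/-- `h Y` estimates how much of the weight of the offline solution `R` is still available once the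
items of `Y` are allocated. As in balanced prices for matroids, what is left of the estimate at an
independent set `A` can be realised by extending `A` inside `R`, and it bounds what the agents
destroy when each of them adds her share of an extension of `A` to a subset of `A`. -/
structure IsBalancedPotential (M : Matroid α) (owner : α → ι) (R : Finset α) (w : α → ℝ)
    (h : Finset α → ℝ) : Prop where
  apply_empty : h ∅ = ∑ i ∈ R, w i
  exists_extension : ∀ A : Finset α, M.Indep (A : Set α) →
    ∃ V ⊆ R, Disjoint A V ∧ M.Indep (A ∪ V : Finset α) ∧ h A ≤ ∑ i ∈ V, w i
  sum_loss_le : ∀ (A V : Finset α) (Y : ι → Finset α), Disjoint A V →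
    M.Indep (A ∪ V : Finset α) → (∀ t, Y t ⊆ A) →
      ∑ t, (h (Y t) - h (Y t ∪ {i ∈ V | owner i = t})) ≤ h A

theorem IsBalancedPotential.add_layer {R' R : Finset α} {w : α → ℝ} {h : Finset α → ℝ} {c : ℝ}
    (hh : IsBalancedPotential M owner R' w h) (hR' : R' ⊆ R) (hR : M.Indep (R : Set α))
    (hw : ∀ i ∈ R, 0 ≤ w i) (hw' : ∀ i ∈ R, i ∉ R' → w i = 0) (hc : 0 ≤ c) :
    IsBalancedPotential M owner R (fun i => w i + c) fun Y => c * contractRk M R Y + h Y where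
  apply_empty := by
    rw [contractRk_empty hR, hh.apply_empty, Finset.sum_subset hR' hw', Finset.sum_add_distrib,
      Finset.sum_const, nsmul_eq_mul, add_comm, mul_comm]
  exists_extension A hA := by
    obtain ⟨V, hVR', hAV, hI, hle⟩ := hh.exists_extension A hA
    obtain ⟨V', hVV', hV'R, hAV', hI', hcard⟩ :=
      exists_extension_card_eq_contractRk (hVR'.trans hR') hAV hI
    refine ⟨V', hV'R, hAV', hI', ?_⟩
    have hsum : ∑ i ∈ V, w i ≤ ∑ i ∈ V', w i :=
      Finset.sum_le_sum_of_subset_of_nonneg hVV' fun i hi _ => hw i (hV'R hi)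
    rw [Finset.sum_add_distrib, Finset.sum_const, nsmul_eq_mul, hcard]
    linarith
  sum_loss_le A V Y hAV hI hY := by
    calc ∑ t, (c * contractRk M R (Y t) + h (Y t) -
            (c * contractRk M R (Y t ∪ {i ∈ V | owner i = t}) + h (Y t ∪ {i ∈ V | owner i = t})))
        = c * ∑ t, (contractRk M R (Y t) - contractRk M R (Y t ∪ {i ∈ V | owner i = t}))
            + ∑ t, (h (Y t) - h (Y t ∪ {i ∈ V | owner i = t})) := by
          rw [Finset.mul_sum, ← Finset.sum_add_distrib]
          exact Finset.sum_congr rfl fun t _ => by ring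
      _ ≤ c * contractRk M R A + h A :=
          add_le_add (mul_le_mul_of_nonneg_left (sum_contractRk_sub_le owner R hAV hI hY) hc)
            (hh.sum_loss_le A V Y hAV hI hY)

theorem isBalancedPotential_empty (w : α → ℝ) : IsBalancedPotential M owner ∅ w 0 where
  apply_empty := rfl
  exists_extension A hA := ⟨∅, subset_rfl, Finset.disjoint_empty_right A, by simpa using hA, le_rfl⟩
  sum_loss_le _ _ _ _ _ _ := by simp

/-- Peeling the items off in increasing order of weight writes `w` as a nonnegative combination of
indicators of nested sets; each of them contributes one layer. -/
theorem exists_isBalancedPotential (owner : α → ι) {R : Finset α} {w : α → ℝ}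
    (hR : M.Indep (R : Set α)) (hw : ∀ i ∈ R, 0 ≤ w i) :
    ∃ h, IsBalancedPotential M owner R w h := by
  suffices hmin : ∀ c, (∀ i ∈ R, c ≤ w i) →
      ∃ h, IsBalancedPotential M owner R (fun i => w i - c) h by
    simpa only [sub_zero] using hmin 0 hw
  clear hw
  induction R using Finset.induction_on_min_value w with
  | empty => exact fun c _ => ⟨0, isBalancedPotential_empty _⟩
  | insert a s _ ha ih =>
    intro c hc
    have hs : s ⊆ insert a s := Finset.subset_insert a s
    obtain ⟨h, hh⟩ := ih (hR.subset (Finset.coe_subset.2 hs)) (w a) ha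
    have hlayer := hh.add_layer hs hR (c := w a - c)
      (by simpa [Finset.forall_mem_insert] using ha) (by simp +contextual)
      (sub_nonneg.2 (hc a (Finset.mem_insert_self a s)))
    simp only [sub_add_sub_cancel] at hlayer
    exact ⟨_, hlayer⟩

end BalancedPotential

section DynamicProgram

variable {α Θ : Type*} [DecidableEq α] {T : ℕ}

open Classical in
/-- The moves from the state `Y` when the items of `A` are available: the sets that can be added
without leaving the admissible states `I`, and the empty set. -/
noncomputable def moves (I : Finset α → Prop) (A Y : Finset α) : Finset (Finset α) :=
  {S ∈ A.powerset | S = ∅ ∨ I (Y ∪ S)}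

theorem mem_moves {I : Finset α → Prop} {A Y S : Finset α} :
    S ∈ moves I A Y ↔ S ⊆ A ∧ (S = ∅ ∨ I (Y ∪ S)) := by
  simp [moves]

theorem exists_optimal_move (I : Finset α → Prop) (A : Finset α) (r g : Finset α → ℝ)
    (Y : Finset α) :
    ∃ S ∈ moves I A Y, ∀ S' ∈ moves I A Y, r S' + g (Y ∪ S') ≤ r S + g (Y ∪ S) :=
  Finset.exists_max_image _ _ ⟨∅, mem_moves.2 ⟨A.empty_subset, Or.inl rfl⟩⟩

/-- A move from `Y` that maximises the reward `r` plus the continuation value `g`. -/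
noncomputable def optimalSet (I : Finset α → Prop) (A : Finset α) (r g : Finset α → ℝ)
    (Y : Finset α) : Finset α :=
  (exists_optimal_move I A r g Y).choose

/-- The reward `r` plus the continuation value `g` of an optimal move from `Y`. -/
noncomputable def optimalGain (I : Finset α → Prop) (A : Finset α) (r g : Finset α → ℝ)
    (Y : Finset α) : ℝ :=
  r (optimalSet I A r g Y) + g (Y ∪ optimalSet I A r g Y)

section Optimal

variable {I : Finset α → Prop} {A Y : Finset α} {r g : Finset α → ℝ}

theorem optimalSet_mem_moves : optimalSet I A r g Y ∈ moves I A Y :=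
  (exists_optimal_move I A r g Y).choose_spec.1

theorem optimalSet_subset : optimalSet I A r g Y ⊆ A :=
  (mem_moves.1 optimalSet_mem_moves).1

theorem admissible_union_optimalSet (hY : I Y) : I (Y ∪ optimalSet I A r g Y) := by
  rcases (mem_moves.1 (optimalSet_mem_moves (I := I) (A := A) (r := r) (g := g))).2 with h | h
  · rwa [h, Finset.union_empty]
  · exact h

theorem le_optimalGain {S : Finset α} (hS : S ∈ moves I A Y) :
    r S + g (Y ∪ S) ≤ optimalGain I A r g Y :=
  (exists_optimal_move I A r g Y).choose_spec.2 S hS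

end Optimal

section ValueToGo

variable [Fintype Θ] (I : Finset α → Prop) (μ : Fin T → Θ → ℝ) (A : Fin T → Θ → Finset α)
  (r : Fin T → Θ → Finset α → ℝ)

/-- The optimal expected reward collected from time `n` on, starting in the state `Y`: at time `t`
the type `θ` is drawn with probability `μ t θ`, and then a subset of `A t θ` is added to the state
for a reward `r t θ`. -/
noncomputable def valueToGo : Fin (T + 1) → Finset α → ℝ :=
  Fin.reverseInduction (motive := fun _ => Finset α → ℝ) 0
    fun t next Y => ∑ θ, μ t θ * optimalGain I (A t θ) (r t θ) next Y

@[simp]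
theorem valueToGo_last (Y : Finset α) : valueToGo I μ A r (Fin.last T) Y = 0 := by
  simp [valueToGo]

theorem valueToGo_castSucc (t : Fin T) (Y : Finset α) :
    valueToGo I μ A r t.castSucc Y =
      ∑ θ, μ t θ * optimalGain I (A t θ) (r t θ) (valueToGo I μ A r t.succ) Y := by
  simp [valueToGo]

end ValueToGo

theorem sum_castSucc_sub_succ (f : Fin (T + 1) → ℝ) :
    ∑ t : Fin T, (f t.castSucc - f t.succ) = f 0 - f (Fin.last T) := by
  rw [Finset.sum_sub_distrib]
  linarith [Fin.sum_univ_castSucc f, Fin.sum_univ_succ f]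

section Potential

variable [Fintype Θ] {I : Finset α → Prop} {μ : Fin T → Θ → ℝ} {A : Fin T → Θ → Finset α}
  {r : Fin T → Θ → Finset α → ℝ}

/-- Among the states reached by moves that are optimal for the continuation value `Φ`, take one at
which `valueToGo - Φ` is smallest: the average over the types is at least this minimum. -/
theorem exists_pessimistic_state (hμ0 : ∀ t θ, 0 ≤ μ t θ) (hμ1 : ∀ t, ∑ θ, μ t θ = 1)
    (Φ : Finset α → ℝ) (t : Fin T) (Y : Finset α) :
    ∃ Y', Y ⊆ Y' ∧ (I Y → I Y') ∧
      ∑ θ, μ t θ * (optimalGain I (A t θ) (r t θ) Φ Y - Φ Y) ≤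
        (valueToGo I μ A r t.castSucc Y - Φ Y) - (valueToGo I μ A r t.succ Y' - Φ Y') := by
  set V := valueToGo I μ A r
  set S : Θ → Finset α := fun θ => optimalSet I (A t θ) (r t θ) Φ Y
  have : Nonempty Θ := by
    by_contra h
    rw [not_nonempty_iff] at h
    simpa using hμ1 t
  obtain ⟨θ₀, hθ₀⟩ := Finite.exists_min fun θ => V t.succ (Y ∪ S θ) - Φ (Y ∪ S θ)
  refine ⟨Y ∪ S θ₀, Finset.subset_union_left, admissible_union_optimalSet, ?_⟩
  set δ := V t.succ (Y ∪ S θ₀) - Φ (Y ∪ S θ₀)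
  have hgain : ∀ θ, optimalGain I (A t θ) (r t θ) Φ Y + δ ≤
      optimalGain I (A t θ) (r t θ) (V t.succ) Y := fun θ => by
    have hle : r t θ (S θ) + V t.succ (Y ∪ S θ) ≤ optimalGain I (A t θ) (r t θ) (V t.succ) Y :=
      le_optimalGain optimalSet_mem_moves
    have hΦ : optimalGain I (A t θ) (r t θ) Φ Y = r t θ (S θ) + Φ (Y ∪ S θ) := rfl
    linarith [hθ₀ θ]
  have hsum := Finset.sum_le_sum fun θ (_ : θ ∈ Finset.univ) =>
    mul_le_mul_of_nonneg_left (hgain θ) (hμ0 t θ)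
  rw [← valueToGo_castSucc] at hsum
  simp only [mul_add, mul_sub, Finset.sum_add_distrib, Finset.sum_sub_distrib, ← Finset.sum_mul,
    hμ1, one_mul] at hsum ⊢
  linarith

theorem potential_le_valueToGo (hμ0 : ∀ t θ, 0 ≤ μ t θ) (hμ1 : ∀ t, ∑ θ, μ t θ = 1) (hI : I ∅)
    {Φ : Finset α → ℝ}
    (hΦ : ∀ Y : Fin (T + 1) → Finset α, Monotone Y → I (Y (Fin.last T)) →
      Φ (Y (Fin.last T)) ≤ ∑ t, ∑ θ, μ t θ *
        (optimalGain I (A t θ) (r t θ) Φ (Y t.castSucc) - Φ (Y t.castSucc))) :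
    Φ ∅ ≤ valueToGo I μ A r 0 ∅ := by
  choose next hsub hadm hle using exists_pessimistic_state (I := I) (A := A) (r := r) hμ0 hμ1 Φ
  set Y : Fin (T + 1) → Finset α := Fin.induction (motive := fun _ => Finset α) ∅ next
  have hsucc : ∀ t : Fin T, Y t.succ = next t (Y t.castSucc) := fun t => Fin.induction_succ ..
  have hmono : Monotone Y := Fin.monotone_iff_le_succ.2 fun t => hsucc t ▸ hsub t _
  have hY : ∀ n, I (Y n) := Fin.induction hI fun t ih => hsucc t ▸ hadm t _ ih
  have hgain := Finset.sum_le_sum fun t (_ : t ∈ Finset.univ) => hle t (Y t.castSucc)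
  simp only [← hsucc] at hgain
  rw [sum_castSucc_sub_succ fun n => valueToGo I μ A r n (Y n) - Φ (Y n), valueToGo_last] at hgain
  have hY0 : Y 0 = ∅ := rfl
  rw [hY0] at hgain
  linarith [hΦ Y hmono (hY _)]

end Potential

section Greedy

variable (I : Finset α → Prop) (A : Fin T → Finset α) (V : Fin (T + 1) → Finset α → ℝ)

/-- The state at time `n` of the policy that always makes an optimal move with respect to the
continuation values `V`, when the rewards are `u`. -/
noncomputable def greedyState (u : Fin T → Finset α → ℝ) : Fin (T + 1) → Finset α :=
  Fin.induction ∅ fun t Y => Y ∪ optimalSet I (A t) (u t) (V t.succ) Y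

/-- The set added at time `t` by the policy `greedyState`. -/
noncomputable def greedySet (u : Fin T → Finset α → ℝ) (t : Fin T) : Finset α :=
  optimalSet I (A t) (u t) (V t.succ) (greedyState I A V u t.castSucc)

@[simp]
theorem greedyState_zero (u : Fin T → Finset α → ℝ) : greedyState I A V u 0 = ∅ := rfl

theorem greedyState_succ (u : Fin T → Finset α → ℝ) (t : Fin T) :
    greedyState I A V u t.succ = greedyState I A V u t.castSucc ∪ greedySet I A V u t := rfl

theorem greedyState_congr {u u' : Fin T → Finset α → ℝ} (n : Fin (T + 1))
    (h : ∀ s : Fin T, s.castSucc < n → u s = u' s) :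
    greedyState I A V u n = greedyState I A V u' n := by
  induction n using Fin.induction with
  | zero => rfl
  | succ t ih =>
    have ih := ih fun s hs => h s (hs.trans Fin.castSucc_lt_succ)
    rw [greedyState_succ, greedyState_succ, greedySet, greedySet, ih,
      h t Fin.castSucc_lt_succ]

theorem greedySet_congr {u u' : Fin T → Finset α → ℝ} (t : Fin T)
    (h : ∀ s ≤ t, u s = u' s) : greedySet I A V u t = greedySet I A V u' t := by
  rw [greedySet, greedySet, h t le_rfl, greedyState_congr I A V t.castSucc fun s hs =>
    h s (Fin.castSucc_lt_castSucc_iff.1 hs).le]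

theorem admissible_greedyState (hI : I ∅) (u : Fin T → Finset α → ℝ) (n : Fin (T + 1)) :
    I (greedyState I A V u n) := by
  induction n using Fin.induction with
  | zero => exact hI
  | succ t ih => exact admissible_union_optimalSet ih

theorem mem_greedyState {u : Fin T → Finset α → ℝ} {n : Fin (T + 1)} {i : α} :
    i ∈ greedyState I A V u n ↔ ∃ t : Fin T, t.castSucc < n ∧ i ∈ greedySet I A V u t := by
  induction n using Fin.induction with
  | zero => simp
  | succ t ih =>
    simp only [greedyState_succ, Finset.mem_union, ih, Fin.castSucc_lt_castSucc_iff,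
      Fin.castSucc_lt_succ_iff, le_iff_lt_or_eq, or_and_right, exists_or, exists_eq_left]

/-- Exchanging the sampled coordinate with the fresh sample is an involution that preserves the
joint distribution of the two. -/
theorem sum_prod_mul_resample {ι : Type*} [Fintype ι] [DecidableEq ι] [Fintype Θ] {p : ι → Θ → ℝ}
    {t : ι} (hp : ∑ j, p t j = 1) (f : (ι → Θ) → Θ → ℝ)
    (hf : ∀ k j l, f (Function.update k t j) l = f k l) :
    ∑ k : ι → Θ, (∏ s, p s (k s)) * ∑ j, p t j * f k j =
      ∑ k : ι → Θ, (∏ s, p s (k s)) * f k (k t) := by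
  have hswap : ∀ k j, (∏ s, p s (Function.update k t j s)) * p t (k t) =
      (∏ s, p s (k s)) * p t j := fun k j => by
    rw [← Finset.mul_prod_erase _ _ (Finset.mem_univ t),
      ← Finset.mul_prod_erase _ (fun s => p s (k s)) (Finset.mem_univ t),
      Finset.prod_congr rfl (g := fun s => p s (k s))
        (fun s hs => by rw [Function.update_of_ne (Finset.ne_of_mem_erase hs)]),
      Function.update_self]
    ring
  let e : (ι → Θ) × Θ → (ι → Θ) × Θ := fun x => (Function.update x.1 t x.2, x.1 t)
  have he : Function.Involutive e := fun x => by simp [e]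
  calc ∑ k : ι → Θ, (∏ s, p s (k s)) * ∑ j, p t j * f k j
      = ∑ x : (ι → Θ) × Θ, (∏ s, p s (x.1 s)) * (p t x.2 * f x.1 x.2) := by
        simp only [Fintype.sum_prod_type, Finset.mul_sum]
    _ = ∑ x : (ι → Θ) × Θ, (∏ s, p s ((e x).1 s)) * (p t (e x).2 * f (e x).1 (e x).2) :=
        (Equiv.sum_comp he.toPerm
          fun x => (∏ s, p s (x.1 s)) * (p t x.2 * f x.1 x.2)).symm
    _ = ∑ x : (ι → Θ) × Θ, p t x.2 * ((∏ s, p s (x.1 s)) * f x.1 (x.1 t)) :=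
        Finset.sum_congr rfl fun x _ => by rw [hf, ← mul_assoc, hswap]; ring
    _ = ∑ k : ι → Θ, (∏ s, p s (k s)) * f k (k t) := by
        simp only [Fintype.sum_prod_type, ← Finset.sum_mul, hp, one_mul]

theorem sum_prod_mul_valueToGo_greedyState [Fintype Θ] {p : Fin T → Θ → ℝ} {t : Fin T}
    (hp : ∑ j, p t j = 1) (r : Fin T → Θ → Finset α → ℝ) {V : Fin (T + 1) → Finset α → ℝ}
    (hV : V = valueToGo I p (fun t _ => A t) r) :
    ∑ k : Fin T → Θ, (∏ s, p s (k s)) *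
        V t.castSucc (greedyState I A V (fun s => r s (k s)) t.castSucc) =
      ∑ k : Fin T → Θ, (∏ s, p s (k s)) * (r t (k t) (greedySet I A V (fun s => r s (k s)) t) +
        V t.succ (greedyState I A V (fun s => r s (k s)) t.succ)) := by
  have hsucc : ∀ X, V t.castSucc X =
      ∑ j, p t j * optimalGain I (A t) (r t j) (V t.succ) X := fun X => by
    rw [hV, valueToGo_castSucc]
  simp only [hsucc]
  refine sum_prod_mul_resample hp (fun k j => optimalGain I (A t) (r t j) (V t.succ)
    (greedyState I A V (fun s => r s (k s)) t.castSucc)) fun k j l => ?_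
  rw [greedyState_congr I A V t.castSucc fun s hs => by
    rw [Function.update_of_ne (Fin.castSucc_lt_castSucc_iff.1 hs).ne]]

theorem sum_prod_mul_sum_greedySet [Fintype Θ] {p : Fin T → Θ → ℝ} (hp : ∀ t, ∑ j, p t j = 1)
    (r : Fin T → Θ → Finset α → ℝ) :
    ∑ k : Fin T → Θ, (∏ s, p s (k s)) * ∑ t, r t (k t)
        (greedySet I A (valueToGo I p (fun t _ => A t) r) (fun s => r s (k s)) t) =
      valueToGo I p (fun t _ => A t) r 0 ∅ := by
  set V := valueToGo I p (fun t _ => A t) r with hV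
  set g : Fin (T + 1) → ℝ := fun n =>
    ∑ k : Fin T → Θ, (∏ s, p s (k s)) * V n (greedyState I A V (fun s => r s (k s)) n) with hg
  have hstep : ∀ t : Fin T, ∑ k : Fin T → Θ, (∏ s, p s (k s)) *
      r t (k t) (greedySet I A V (fun s => r s (k s)) t) = g t.castSucc - g t.succ := fun t => by
    have h := sum_prod_mul_valueToGo_greedyState I A (hp t) r hV
    simp only [mul_add, Finset.sum_add_distrib] at h
    exact eq_sub_of_add_eq h.symm
  have hmass : ∑ k : Fin T → Θ, ∏ s, p s (k s) = 1 := by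
    rw [← Fintype.piFinset_univ, ← Finset.prod_univ_sum]
    simp [hp]
  have h0 : g 0 = V 0 ∅ := by
    simp only [hg, greedyState_zero, ← Finset.sum_mul, hmass, one_mul]
  have hlast : g (Fin.last T) = 0 := by simp [hg, hV]
  calc _ = ∑ t, ∑ k : Fin T → Θ, (∏ s, p s (k s)) *
          r t (k t) (greedySet I A V (fun s => r s (k s)) t) := by
        simp only [Finset.mul_sum]
        exact Finset.sum_comm
    _ = ∑ t : Fin T, (g t.castSucc - g t.succ) := Finset.sum_congr rfl fun t _ => hstep t
    _ = V 0 ∅ := by rw [sum_castSucc_sub_succ, h0, hlast, sub_zero]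

end Greedy

end DynamicProgram

section MatroidProphet

variable {α Ω : Type*} [DecidableEq α] [Fintype Ω] {T : ℕ} {M : Matroid α} {owner : α → Fin T}
  {q : Ω → ℝ} {R : Ω → Finset α} {w : Ω → α → ℝ}

/-- The optimal value-to-go when only the matroid constrains the allocation, and every agent draws
a fresh scenario `ω` and may then take any of her items in the offline solution `R ω`, for an
additive reward `w ω`. -/
noncomputable def matroidValue (M : Matroid α) (owner : α → Fin T) (q : Ω → ℝ) (R : Ω → Finset α)
    (w : Ω → α → ℝ) : Fin (T + 1) → Finset α → ℝ :=
  valueToGo (fun Y => M.Indep (Y : Set α)) (fun _ => q) (fun t ω => {i ∈ R ω | owner i = t})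
    (fun _ ω S => ∑ i ∈ S, w ω i)

theorem matroidValue_antitone (hq0 : ∀ ω, 0 ≤ q ω) (n : Fin (T + 1)) :
    Antitone (matroidValue M owner q R w n) := by
  induction n using Fin.reverseInduction with
  | last => exact fun Y Y' _ => by simp [matroidValue]
  | cast t ih =>
    intro Y Y' hYY'
    simp only [matroidValue, valueToGo_castSucc] at ih ⊢
    refine Finset.sum_le_sum fun ω _ => mul_le_mul_of_nonneg_left ?_ (hq0 ω)
    rw [optimalGain]
    set S := optimalSet _ _ _ _ Y' with hS
    have hsub : Y ∪ S ⊆ Y' ∪ S := Finset.union_subset_union_left hYY'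
    have hmem : S ∈ moves (fun X => M.Indep (X : Set α)) {i ∈ R ω | owner i = t} Y := by
      obtain ⟨hSR, hI⟩ := mem_moves.1 (hS ▸ optimalSet_mem_moves)
      exact mem_moves.2 ⟨hSR, hI.imp_right fun h => h.subset (Finset.coe_subset.2 hsub)⟩
    exact (add_le_add_right (ih hsub) _).trans
      (le_optimalGain (r := fun S => ∑ i ∈ S, w ω i) hmem)

theorem le_matroidValue_of_free (hq0 : ∀ ω, 0 ≤ q ω) (hq1 : ∑ ω, q ω = 1)
    (hM : ∀ S ⊆ M.E, M.Indep S) (hR : ∀ ω, (R ω : Set α) ⊆ M.E) :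
    ∑ ω, q ω * ∑ i ∈ R ω, w ω i ≤ matroidValue M owner q R w 0 ∅ := by
  refine potential_le_valueToGo (fun _ => hq0) (fun _ => hq1) (by simp)
    (Φ := fun _ => ∑ ω, q ω * ∑ i ∈ R ω, w ω i) fun Y hY hI => ?_
  rw [Finset.sum_comm]
  refine Finset.sum_le_sum fun ω _ => ?_
  rw [← Finset.mul_sum, ← Finset.sum_fiberwise (R ω) owner]
  refine mul_le_mul_of_nonneg_left (Finset.sum_le_sum fun t _ => ?_) (hq0 ω)
  refine le_sub_iff_add_le.2 (le_optimalGain (r := fun S => ∑ i ∈ S, w ω i)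
    (g := fun _ => ∑ ω, q ω * ∑ i ∈ R ω, w ω i) (mem_moves.2 ⟨subset_rfl, Or.inr (hM _ ?_)⟩))
  rw [Finset.coe_union]
  exact Set.union_subset ((Finset.coe_subset.2 (hY (Fin.le_last _))).trans hI.subset_ground)
    ((Finset.coe_subset.2 (Finset.filter_subset _ _)).trans (hR ω))

theorem sub_half_le_sum_optimalGain {h : Ω → Finset α → ℝ} (hq0 : ∀ ω, 0 ≤ q ω)
    (hh : ∀ ω, IsBalancedPotential M owner (R ω) (w ω) (h ω)) {F : Finset α → ℝ}
    (hF : F = fun X => ∑ ω, q ω * h ω X) {A : Finset α} (hA : M.Indep (A : Set α))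
    {Y : Fin T → Finset α} (hY : ∀ t, Y t ⊆ A) (ω : Ω) :
    h ω A - F A / 2 ≤ ∑ t, (optimalGain (fun X => M.Indep (X : Set α)) {i ∈ R ω | owner i = t}
      (fun S => ∑ i ∈ S, w ω i) (fun X => F X / 2) (Y t) - F (Y t) / 2) := by
  obtain ⟨V, hVR, hAV, hI, hle⟩ := (hh ω).exists_extension A hA
  set share : Fin T → Finset α := fun t => {i ∈ V | owner i = t}
  have hgain : ∀ t, ∑ i ∈ share t, w ω i + F (Y t ∪ share t) / 2 ≤
      optimalGain (fun X => M.Indep (X : Set α)) {i ∈ R ω | owner i = t}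
        (fun S => ∑ i ∈ S, w ω i) (fun X => F X / 2) (Y t) := fun t =>
    le_optimalGain (r := fun S => ∑ i ∈ S, w ω i) (g := fun X => F X / 2)
      (mem_moves.2 ⟨Finset.filter_subset_filter _ hVR, Or.inr (hI.subset (Finset.coe_subset.2
        (Finset.union_subset_union (hY t) (Finset.filter_subset _ _))))⟩)
  have hloss : ∑ t, (F (Y t) - F (Y t ∪ share t)) ≤ F A := by
    simp only [hF, ← Finset.sum_sub_distrib, ← mul_sub]
    rw [Finset.sum_comm]
    refine Finset.sum_le_sum fun ω' _ => ?_
    rw [← Finset.mul_sum]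
    exact mul_le_mul_of_nonneg_left ((hh ω').sum_loss_le A V Y hAV hI hY) (hq0 ω')
  calc h ω A - F A / 2
      ≤ ∑ i ∈ V, w ω i - (∑ t, (F (Y t) - F (Y t ∪ share t))) / 2 := by linarith
    _ = ∑ t, (∑ i ∈ share t, w ω i + F (Y t ∪ share t) / 2 - F (Y t) / 2) := by
        rw [← Finset.sum_fiberwise V owner, Finset.sum_div, ← Finset.sum_sub_distrib]
        exact Finset.sum_congr rfl fun t _ => by ring
    _ ≤ _ := Finset.sum_le_sum fun t _ => sub_le_sub_right (hgain t) _

theorem half_le_matroidValue (hq0 : ∀ ω, 0 ≤ q ω) (hq1 : ∑ ω, q ω = 1)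
    (hR : ∀ ω, M.Indep (R ω : Set α)) (hw : ∀ ω, ∀ i ∈ R ω, 0 ≤ w ω i) :
    (∑ ω, q ω * ∑ i ∈ R ω, w ω i) / 2 ≤ matroidValue M owner q R w 0 ∅ := by
  choose h hh using fun ω => exists_isBalancedPotential owner (hR ω) (hw ω)
  set F : Finset α → ℝ := fun X => ∑ ω, q ω * h ω X with hF
  have hpot : F ∅ / 2 ≤ matroidValue M owner q R w 0 ∅ := by
    refine potential_le_valueToGo (fun _ => hq0) (fun _ => hq1) (by simp)
      (Φ := fun X => F X / 2) fun Y hY hI => ?_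
    have hgain := Finset.sum_le_sum fun ω (_ : ω ∈ Finset.univ) => mul_le_mul_of_nonneg_left
      (sub_half_le_sum_optimalGain hq0 hh hF hI (fun t => hY (Fin.le_last t.castSucc)) ω) (hq0 ω)
    rw [Finset.sum_comm]
    simp only [← Finset.mul_sum]
    refine le_trans (le_of_eq ?_) hgain
    simp only [mul_sub, Finset.sum_sub_distrib, ← Finset.sum_mul, hq1]
    ring
  simpa only [hF, (hh _).apply_empty] using hpot

theorem le_matroidValue (hq0 : ∀ ω, 0 ≤ q ω) (hq1 : ∑ ω, q ω = 1)
    (hR : ∀ ω, M.Indep (R ω : Set α)) (hw : ∀ ω, ∀ i ∈ R ω, 0 ≤ w ω i) :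
    (∑ ω, q ω * ∑ i ∈ R ω, w ω i) / (d1 M + 1) ≤ matroidValue M owner q R w 0 ∅ := by
  by_cases hM : ∀ S ⊆ M.E, M.Indep S
  · rw [d1, if_pos hM, Nat.cast_zero, zero_add, div_one]
    exact le_matroidValue_of_free hq0 hq1 hM fun ω => (hR ω).subset_ground
  · rw [d1, if_neg hM, Nat.cast_one, one_add_one_eq_two]
    exact half_le_matroidValue hq0 hq1 hR hw

end MatroidProphet

section GraphPrices

variable {α Ω : Type*} [Fintype α] [Fintype Ω] {T : ℕ}

section Neighbors

variable (G : SimpleGraph α) [DecidableRel G.Adj] (owner : α → Fin T)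

/-- The neighbours of an item that belong to later agents. -/
def laterNeighbors (i : α) : Finset α :=
  {j | G.Adj i j ∧ owner i < owner j}

/-- The items owned from time `n` on that are adjacent to an item of `Y`. -/
def blockedItems (n : Fin (T + 1)) (Y : Finset α) : Finset α :=
  {i | n ≤ (owner i).castSucc ∧ ∃ j ∈ Y, G.Adj j i}

variable {G owner}

theorem mem_laterNeighbors {i j : α} :
    j ∈ laterNeighbors G owner i ↔ G.Adj i j ∧ owner i < owner j := by
  simp [laterNeighbors]

theorem mem_blockedItems {n : Fin (T + 1)} {Y : Finset α} {i : α} :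
    i ∈ blockedItems G owner n Y ↔ n ≤ (owner i).castSucc ∧ ∃ j ∈ Y, G.Adj j i := by
  simp [blockedItems]

end Neighbors

variable [DecidableEq α]

section Definitions

variable (G : SimpleGraph α) [DecidableRel G.Adj] (owner : α → Fin T) (q : Ω → ℝ)
  (R : Ω → Finset α) (w : Ω → α → ℝ)

/-- The expected weight that an item `i` contributes to the offline solution `R ω` after paying
each of its later neighbours a compensation equal to that neighbour's own price. -/
noncomputable def itemPrice (i : α) : ℝ :=
  ∑ ω with i ∈ R ω, q ω *
    max 0 (w ω i - ∑ j ∈ (laterNeighbors G owner i).attach, itemPrice j)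
termination_by T - owner i
decreasing_by
  have := (mem_laterNeighbors.1 j.2).2
  omega

/-- The compensation that an item pays to its later neighbours, which it may block. -/
noncomputable def compensation (i : α) : ℝ :=
  ∑ j ∈ laterNeighbors G owner i, itemPrice G owner q R w j

/-- The positive part of the weight of an item minus its compensation. -/
noncomputable def netWeight (ω : Ω) (i : α) : ℝ :=
  max 0 (w ω i - compensation G owner q R w i)

end Definitions

variable {G : SimpleGraph α} [DecidableRel G.Adj] {owner : α → Fin T} {q : Ω → ℝ}
  {R : Ω → Finset α} {w : Ω → α → ℝ}

theorem itemPrice_eq (i : α) :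
    itemPrice G owner q R w i = ∑ ω with i ∈ R ω, q ω * netWeight G owner q R w ω i := by
  rw [itemPrice]
  simp only [netWeight, compensation,
    Finset.sum_attach (laterNeighbors G owner i) (itemPrice G owner q R w)]

theorem netWeight_nonneg (ω : Ω) (i : α) : 0 ≤ netWeight G owner q R w ω i :=
  le_max_left _ _

theorem sub_compensation_le_netWeight (ω : Ω) (i : α) :
    w ω i - compensation G owner q R w i ≤ netWeight G owner q R w ω i :=
  le_max_right _ _

theorem itemPrice_nonneg (hq0 : ∀ ω, 0 ≤ q ω) (i : α) : 0 ≤ itemPrice G owner q R w i := by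
  rw [itemPrice_eq]
  exact Finset.sum_nonneg fun ω _ => mul_nonneg (hq0 ω) (netWeight_nonneg ω i)

theorem sum_itemPrice (X : Finset α) :
    ∑ i ∈ X, itemPrice G owner q R w i =
      ∑ ω, q ω * ∑ i ∈ R ω with i ∈ X, netWeight G owner q R w ω i := by
  simp only [itemPrice_eq, Finset.mul_sum]
  exact Finset.sum_comm' (by simp [and_comm])

theorem sum_compensation_le (hq0 : ∀ ω, 0 ≤ q ω) {X : Finset α} {d : ℕ}
    (hd : ∀ i, ({j ∈ X | i ∈ laterNeighbors G owner j} : Finset α).card ≤ d) :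
    ∑ i ∈ X, compensation G owner q R w i ≤ d * ∑ i, itemPrice G owner q R w i := by
  calc ∑ i ∈ X, compensation G owner q R w i
      = ∑ j, ∑ i ∈ X with j ∈ laterNeighbors G owner i, itemPrice G owner q R w j :=
        Finset.sum_comm' (by simp)
    _ = ∑ j, ({i ∈ X | j ∈ laterNeighbors G owner i} : Finset α).card *
          itemPrice G owner q R w j := by
        simp only [Finset.sum_const, nsmul_eq_mul]
    _ ≤ ∑ j, d * itemPrice G owner q R w j := Finset.sum_le_sum fun j _ =>
        mul_le_mul_of_nonneg_right (Nat.cast_le.2 (hd j)) (itemPrice_nonneg hq0 j)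
    _ = d * ∑ i, itemPrice G owner q R w i := (Finset.mul_sum _ _ _).symm

theorem sum_weight_le_sum_itemPrice (hq0 : ∀ ω, 0 ≤ q ω) (hq1 : ∑ ω, q ω = 1) {d : ℕ}
    (hd : ∀ ω i, ({j ∈ R ω | i ∈ laterNeighbors G owner j} : Finset α).card ≤ d) :
    ∑ ω, q ω * ∑ i ∈ R ω, w ω i ≤ (d + 1) * ∑ i, itemPrice G owner q R w i := by
  set P := ∑ i, itemPrice G owner q R w i with hP
  have hω : ∀ ω, ∑ i ∈ R ω, w ω i ≤ ∑ i ∈ R ω, netWeight G owner q R w ω i + d * P := fun ω => by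
    have hnet := Finset.sum_le_sum fun i (_ : i ∈ R ω) =>
      sub_compensation_le_netWeight (G := G) (owner := owner) (q := q) (R := R) (w := w) ω i
    rw [Finset.sum_sub_distrib] at hnet
    linarith [sum_compensation_le (q := q) (R := R) (w := w) hq0 (hd ω)]
  calc ∑ ω, q ω * ∑ i ∈ R ω, w ω i
      ≤ ∑ ω, q ω * (∑ i ∈ R ω, netWeight G owner q R w ω i + d * P) :=
        Finset.sum_le_sum fun ω _ => mul_le_mul_of_nonneg_left (hω ω) (hq0 ω)
    _ = P + d * P := by
        rw [hP, sum_itemPrice]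
        simp [mul_add, Finset.sum_add_distrib, ← Finset.sum_mul, hq1]
    _ = (d + 1) * P := by ring

theorem sum_blockedItems_castSucc (t : Fin T) (Y : Finset α) :
    ∑ i ∈ blockedItems G owner t.castSucc Y, itemPrice G owner q R w i =
      ∑ i ∈ blockedItems G owner t.succ Y, itemPrice G owner q R w i +
      ∑ ω, q ω * ∑ i ∈ R ω with owner i = t ∧ ∃ j ∈ Y, G.Adj j i,
        netWeight G owner q R w ω i := by
  have hnow : (blockedItems G owner t.castSucc Y).filter (owner · = t) =
      ({i | owner i = t ∧ ∃ j ∈ Y, G.Adj j i} : Finset α) := by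
    ext i
    simp only [Finset.mem_filter, mem_blockedItems, Finset.mem_univ, true_and,
      Fin.castSucc_le_castSucc_iff]
    grind
  have hlater : (blockedItems G owner t.castSucc Y).filter (¬ owner · = t) =
      blockedItems G owner t.succ Y := by
    ext i
    simp only [Finset.mem_filter, mem_blockedItems, Fin.castSucc_le_castSucc_iff,
      Fin.succ_le_castSucc_iff]
    grind
  rw [← Finset.sum_filter_add_sum_filter_not _ (fun i => owner i = t), hnow, hlater, add_comm,
    sum_itemPrice {i | owner i = t ∧ ∃ j ∈ Y, G.Adj j i}]
  simp only [Finset.mem_filter, Finset.mem_univ, true_and]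

theorem sum_blockedItems_union_le (hq0 : ∀ ω, 0 ≤ q ω) {t : Fin T} (Y : Finset α)
    {S : Finset α} (hS : ∀ i ∈ S, owner i = t) :
    ∑ i ∈ blockedItems G owner t.succ (Y ∪ S), itemPrice G owner q R w i ≤
      ∑ i ∈ blockedItems G owner t.succ Y, itemPrice G owner q R w i +
      ∑ i ∈ S, compensation G owner q R w i := by
  set P : Finset α → ℝ := fun X => ∑ i ∈ X, itemPrice G owner q R w i
  have hunion : ∀ {X X' : Finset α}, P (X ∪ X') ≤ P X + P X' := fun {X X'} => by
    rw [← Finset.sum_union_inter]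
    exact le_add_of_nonneg_right (Finset.sum_nonneg fun i _ => itemPrice_nonneg hq0 i)
  have hsub : blockedItems G owner t.succ (Y ∪ S) ⊆
      blockedItems G owner t.succ Y ∪ S.biUnion (laterNeighbors G owner) := fun i hi => by
    obtain ⟨hti, j, hj, hji⟩ := mem_blockedItems.1 hi
    rcases Finset.mem_union.1 hj with hj | hj
    · exact Finset.mem_union_left _ (mem_blockedItems.2 ⟨hti, j, hj, hji⟩)
    · exact Finset.mem_union_right _ (Finset.mem_biUnion.2
        ⟨j, hj, mem_laterNeighbors.2 ⟨hji, hS j hj ▸ Fin.succ_le_castSucc_iff.1 hti⟩⟩)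
  calc P (blockedItems G owner t.succ (Y ∪ S))
      ≤ P (blockedItems G owner t.succ Y ∪ S.biUnion (laterNeighbors G owner)) :=
        Finset.sum_le_sum_of_subset_of_nonneg hsub fun i _ _ => itemPrice_nonneg hq0 i
    _ ≤ P (blockedItems G owner t.succ Y) + P (S.biUnion (laterNeighbors G owner)) := hunion
    _ ≤ _ := by
        rw [← Finset.sup_eq_biUnion]
        exact add_le_add_right (S.apply_sup_le_sum (f := P) Finset.sum_empty hunion) _

end GraphPrices

section Comparison

/-- The states admissible for the online problem: the sets of items that are independent both in
the matroid and in the graph. -/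
def JointlyIndep {α : Type*} (M : Matroid α) (G : SimpleGraph α) (Y : Finset α) : Prop :=
  M.Indep (Y : Set α) ∧ G.IsIndepSet (Y : Set α)

theorem jointlyIndep_empty {α : Type*} (M : Matroid α) (G : SimpleGraph α) :
    JointlyIndep M G ∅ := by
  simp [JointlyIndep, SimpleGraph.IsIndepSet]

theorem JointlyIndep.union {α : Type*} [DecidableEq α] {M : Matroid α} {G : SimpleGraph α}
    {Y S : Finset α} (hY : JointlyIndep M G Y) (hS : G.IsIndepSet (S : Set α))
    (hI : M.Indep ((Y ∪ S : Finset α) : Set α)) (hYS : ∀ i ∈ S, ¬ ∃ j ∈ Y, G.Adj j i) :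
    JointlyIndep M G (Y ∪ S) := by
  refine ⟨hI, fun i hi j hj hne hadj => ?_⟩
  rcases Finset.mem_union.1 hi with hi | hi <;> rcases Finset.mem_union.1 hj with hj | hj
  · exact hY.2 hi hj hne hadj
  · exact hYS j hj ⟨i, hi, hadj⟩
  · exact hYS i hi ⟨j, hj, hadj.symm⟩
  · exact hS hi hj hne hadj

theorem IsCoupling.sum_marginal {T K : ℕ} {p : Fin T → Fin K → ℝ} {q : (Fin T → Fin K) → ℝ}
    (hq : IsCoupling p q) (t : Fin T) (f : Fin K → ℝ) :
    ∑ j, p t j * f j = ∑ k, q k * f (k t) := by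
  rw [← Finset.sum_fiberwise (s := Finset.univ) (g := fun k : Fin T → Fin K => k t)]
  refine Finset.sum_congr rfl fun j _ => ?_
  rw [← hq.marginal t j, Finset.sum_mul]
  exact Finset.sum_congr rfl fun k hk => by rw [(Finset.mem_filter.1 hk).2]

theorem IsCoupling.pos_marginal {T K : ℕ} {p : Fin T → Fin K → ℝ} {q : (Fin T → Fin K) → ℝ}
    (hq : IsCoupling p q) {k : Fin T → Fin K} (hk : 0 < q k) (t : Fin T) : 0 < p t (k t) := by
  rw [← hq.marginal t (k t)]
  exact hk.trans_le (Finset.single_le_sum (fun k _ => hq.nonneg k)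
    (Finset.mem_filter.2 ⟨Finset.mem_univ k, rfl⟩))

variable {α Ω : Type*} [Fintype α] [DecidableEq α] [Fintype Ω] {T : ℕ}

/-- The part of `S` that a policy can take from the state `Y` without losing on any item: the items
that are not adjacent to an item of `Y` and whose weight covers their compensation. -/
noncomputable def affordableItems (G : SimpleGraph α) [DecidableRel G.Adj] (owner : α → Fin T)
    (q : Ω → ℝ) (R : Ω → Finset α) (w : Ω → α → ℝ) (ω : Ω) (Y S : Finset α) : Finset α :=
  {i ∈ S | (¬ ∃ j ∈ Y, G.Adj j i) ∧ compensation G owner q R w i ≤ w ω i}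

/-- The optimal expected value-to-go of an online algorithm: at time `t` it may add any items of
agent `t`, whose valuation `r t k` realizes with probability `p t k`, as long as the state remains
independent in both the matroid and the graph. -/
noncomputable def onlineValue {Θ : Type*} [Fintype Θ] (M : Matroid α) (G : SimpleGraph α)
    (owner : α → Fin T) (p : Fin T → Θ → ℝ) (r : Fin T → Θ → Finset α → ℝ) :
    Fin (T + 1) → Finset α → ℝ :=
  valueToGo (JointlyIndep M G) p (fun t _ => {i | owner i = t}) r

variable {M : Matroid α} {G : SimpleGraph α} [DecidableRel G.Adj] {owner : α → Fin T}
  {q : Ω → ℝ} {R : Ω → Finset α} {w : Ω → α → ℝ}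

theorem sum_netWeight_le {ω : Ω} {t : Fin T} (Y : Finset α) {S : Finset α}
    (hS : S ⊆ {i ∈ R ω | owner i = t}) :
    ∑ i ∈ S, netWeight G owner q R w ω i ≤
      ∑ i ∈ affordableItems G owner q R w ω Y S, (w ω i - compensation G owner q R w i) +
      ∑ i ∈ R ω with owner i = t ∧ ∃ j ∈ Y, G.Adj j i, netWeight G owner q R w ω i := by
  have hblocked : ∑ i ∈ S with ∃ j ∈ Y, G.Adj j i, netWeight G owner q R w ω i ≤
      ∑ i ∈ R ω with owner i = t ∧ ∃ j ∈ Y, G.Adj j i, netWeight G owner q R w ω i := by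
    rw [← Finset.filter_filter]
    exact Finset.sum_le_sum_of_subset_of_nonneg (Finset.filter_subset_filter _ hS)
      fun i _ _ => netWeight_nonneg ω i
  have hfree : ∑ i ∈ S with ¬ ∃ j ∈ Y, G.Adj j i, netWeight G owner q R w ω i =
      ∑ i ∈ affordableItems G owner q R w ω Y S, (w ω i - compensation G owner q R w i) := by
    rw [affordableItems, ← Finset.filter_filter,
      Finset.sum_filter fun i => compensation G owner q R w i ≤ w ω i]
    refine Finset.sum_congr rfl fun i _ => ?_
    rw [netWeight]
    split_ifs with h
    · exact max_eq_right (sub_nonneg.2 h)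
    · exact max_eq_left (sub_nonpos.2 (le_of_not_ge h))
  rw [← Finset.sum_filter_add_sum_filter_not S fun i => ∃ j ∈ Y, G.Adj j i]
  linarith

theorem optimalGain_netWeight_le (hq0 : ∀ ω, 0 ≤ q ω) {ω : Ω} (hR : G.IsIndepSet (R ω : Set α))
    {t : Fin T} {u W V : Finset α → ℝ} (hW : Antitone W)
    (hu : ∀ S : Finset α, (∀ i ∈ S, owner i = t) → ∑ i ∈ S, w ω i ≤ u S)
    (hWV : ∀ Y, JointlyIndep M G Y →
      W Y - ∑ i ∈ blockedItems G owner t.succ Y, itemPrice G owner q R w i ≤ V Y)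
    {Y : Finset α} (hY : JointlyIndep M G Y) :
    optimalGain (fun X => M.Indep (X : Set α)) {i ∈ R ω | owner i = t}
        (fun S => ∑ i ∈ S, netWeight G owner q R w ω i) W Y ≤
      ∑ i ∈ blockedItems G owner t.succ Y, itemPrice G owner q R w i +
      ∑ i ∈ R ω with owner i = t ∧ ∃ j ∈ Y, G.Adj j i, netWeight G owner q R w ω i +
      optimalGain (JointlyIndep M G) {i | owner i = t} u V Y := by
  rw [optimalGain.eq_def fun X : Finset α => M.Indep (X : Set α)]
  set S := optimalSet (fun X : Finset α => M.Indep (X : Set α)) _ _ _ Y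
  set S' := affordableItems G owner q R w ω Y S
  have hS : S ⊆ {i ∈ R ω | owner i = t} := optimalSet_subset
  have hS'S : S' ⊆ S := Finset.filter_subset _ _
  have hown : ∀ i ∈ S', owner i = t := fun i hi => (Finset.mem_filter.1 (hS (hS'S hi))).2
  have hsub : Y ∪ S' ⊆ Y ∪ S := Finset.union_subset_union_right hS'S
  have hJ : JointlyIndep M G (Y ∪ S') := by
    refine hY.union (hR.mono fun i hi => (Finset.mem_filter.1 (hS (hS'S hi))).1)
      (Matroid.Indep.subset ?_ (Finset.coe_subset.2 hsub))
      fun i hi => (Finset.mem_filter.1 hi).2.1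
    exact admissible_union_optimalSet (I := fun X : Finset α => M.Indep (X : Set α)) hY.1
  have hmove : u S' + V (Y ∪ S') ≤ optimalGain (JointlyIndep M G) {i | owner i = t} u V Y :=
    le_optimalGain (mem_moves.2 ⟨fun i hi => by simpa using hown i hi, Or.inr hJ⟩)
  have hnet := sum_netWeight_le (q := q) (w := w) (G := G) Y hS
  rw [Finset.sum_sub_distrib] at hnet
  linarith [hW hsub, hu S' hown, hWV _ hJ,
    sum_blockedItems_union_le (G := G) (R := R) (w := w) hq0 Y hown]

theorem matroidValue_sub_le_onlineValue {K : ℕ} {p : Fin T → Fin K → ℝ}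
    {q : (Fin T → Fin K) → ℝ} {R : (Fin T → Fin K) → Finset α} {w : (Fin T → Fin K) → α → ℝ}
    {r : Fin T → Fin K → Finset α → ℝ} (hq : IsCoupling p q)
    (hR : ∀ k, G.IsIndepSet (R k : Set α))
    (hr : ∀ k, 0 < q k → ∀ t, ∀ S : Finset α, (∀ i ∈ S, owner i = t) →
      ∑ i ∈ S, w k i ≤ r t (k t) S)
    (n : Fin (T + 1)) {Y : Finset α} (hY : JointlyIndep M G Y) :
    matroidValue M owner q R (netWeight G owner q R w) n Y -
        ∑ i ∈ blockedItems G owner n Y, itemPrice G owner q R w i ≤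
      onlineValue M G owner p r n Y := by
  induction n using Fin.reverseInduction generalizing Y with
  | last =>
    simp only [matroidValue, onlineValue, valueToGo_last, zero_sub, Left.neg_nonpos_iff]
    exact Finset.sum_nonneg fun i _ => itemPrice_nonneg hq.nonneg i
  | cast t ih =>
    rw [onlineValue, valueToGo_castSucc, hq.sum_marginal t, matroidValue, valueToGo_castSucc,
      sum_blockedItems_castSucc, sub_le_iff_le_add', add_assoc, ← Finset.sum_add_distrib,
      ← one_mul (∑ i ∈ blockedItems _ _ _ _, _), ← hq.sum_eq_one, Finset.sum_mul,
      ← Finset.sum_add_distrib]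
    refine Finset.sum_le_sum fun k _ => ?_
    rw [← mul_add, ← mul_add, ← add_assoc]
    rcases (hq.nonneg k).eq_or_lt with h0 | hk
    · simp [← h0]
    · exact mul_le_mul_of_nonneg_left (optimalGain_netWeight_le hq.nonneg (hR k)
        (matroidValue_antitone hq.nonneg t.succ) (hr k hk t) (fun Y hY => ih hY) hY) hk.le

theorem le_onlineValue {K : ℕ} {p : Fin T → Fin K → ℝ}
    {q : (Fin T → Fin K) → ℝ} {R : (Fin T → Fin K) → Finset α} {w : (Fin T → Fin K) → α → ℝ}
    {r : Fin T → Fin K → Finset α → ℝ} (hq : IsCoupling p q)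
    (hR : ∀ k, JointlyIndep M G (R k)) {d : ℕ}
    (hd : ∀ k i, ({j ∈ R k | i ∈ laterNeighbors G owner j} : Finset α).card ≤ d)
    (hr : ∀ k, 0 < q k → ∀ t, ∀ S : Finset α, (∀ i ∈ S, owner i = t) →
      ∑ i ∈ S, w k i ≤ r t (k t) S) :
    (∑ k, q k * ∑ i ∈ R k, w k i) / ((d1 M + 1) * (d + 1)) ≤ onlineValue M G owner p r 0 ∅ := by
  have hblocked : blockedItems G owner 0 ∅ = ∅ := by simp [blockedItems]
  have hsub := matroidValue_sub_le_onlineValue hq (fun k => (hR k).2) hr 0 (jointlyIndep_empty M G)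
  rw [hblocked, Finset.sum_empty, sub_zero] at hsub
  have hprice := sum_itemPrice (G := G) (owner := owner) (q := q) (R := R) (w := w) Finset.univ
  simp only [Finset.mem_univ, Finset.filter_true] at hprice
  calc (∑ k, q k * ∑ i ∈ R k, w k i) / ((d1 M + 1) * (d + 1))
      ≤ (∑ i, itemPrice G owner q R w i) / (d1 M + 1) := by
        rw [mul_comm, ← div_div]
        gcongr
        rw [div_le_iff₀' (by positivity)]
        exact sum_weight_le_sum_itemPrice hq.nonneg hq.sum_eq_one hd
    _ ≤ matroidValue M owner q R (netWeight G owner q R w) 0 ∅ := by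
        rw [hprice]
        exact le_matroidValue hq.nonneg hq.sum_eq_one (fun k => (hR k).1)
          fun k i _ => netWeight_nonneg k i
    _ ≤ onlineValue M G owner p r 0 ∅ := hsub

end Comparison

theorem IsAdditive.eq_sum {α : Type*} {u : SetValuation α} (hu : IsAdditive u) (S : Finset α) :
    u S = ∑ a ∈ S, u {a} := by
  induction S using Finset.cons_induction with
  | empty => simpa using hu ∅ ∅ (Finset.disjoint_empty_left _)
  | cons a s ha ih =>
    rw [Finset.sum_cons, ← ih, hu {a} s (Finset.disjoint_singleton_left.2 ha),
      Finset.singleton_disjUnion]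

theorem IsXOS.exists_support {α : Type*} {u : SetValuation α} (hu : IsXOS u) (S : Finset α) :
    ∃ c : α → ℝ, (∀ S', ∑ a ∈ S', c a ≤ u S') ∧ ∑ a ∈ S, c a = u S := by
  obtain ⟨L, f, hf, hmax⟩ := hu
  obtain ⟨l, hl⟩ := (hmax S).1
  refine ⟨fun a => f l {a}, fun S' => ?_, ?_⟩
  · exact (hf l).eq_sum S' ▸ (hmax S').2 ⟨l, rfl⟩
  · exact (hf l).eq_sum S ▸ hl

section AgentAllocation

variable {T K : ℕ} {N : Fin T → Type*}

/-- The items of agent `t` in a set of items. -/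
noncomputable def agentPart (t : Fin T) (S : Finset (Σ t, N t)) : Finset (N t) :=
  S.preimage (Sigma.mk t) sigma_mk_injective.injOn

theorem mem_agentPart {t : Fin T} {S : Finset (Σ t, N t)} {a : N t} :
    a ∈ agentPart t S ↔ ⟨t, a⟩ ∈ S :=
  Finset.mem_preimage

theorem sum_agentPart {t : Fin T} {S : Finset (Σ t, N t)} (hS : ∀ i ∈ S, i.1 = t)
    (f : (Σ t, N t) → ℝ) : ∑ a ∈ agentPart t S, f ⟨t, a⟩ = ∑ i ∈ S, f i :=
  Finset.sum_preimage _ _ _ _ fun ⟨s, a⟩ hi hrange => by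
    obtain rfl : s = t := hS _ hi
    exact absurd ⟨a, rfl⟩ hrange

variable [∀ t, Fintype (N t)]

theorem exists_welfare_eq_maxWelfare (M : Matroid (Σ t, N t)) (G : SimpleGraph (Σ t, N t))
    (u : ∀ t, SetValuation (N t)) : ∃ Y, Feasible M G Y ∧ welfare u Y = maxWelfare M G u := by
  classical
  obtain ⟨Y, hY, h⟩ := Finset.exists_mem_eq_sup' (s := Finset.univ.filter (Feasible M G))
    ⟨fun _ => ∅, by simp [feasible_empty]⟩ (welfare u)
  exact ⟨Y, (Finset.mem_filter.1 hY).2, h.symm⟩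

variable [∀ t, DecidableEq (N t)]

theorem card_filter_laterNeighbors_le_d2 {G : SimpleGraph (Σ t, N t)} [DecidableRel G.Adj]
    {Y : Finset (Σ t, N t)} (hY : G.IsIndepSet (Y : Set (Σ t, N t))) (i : Σ t, N t) :
    ({j ∈ Y | i ∈ laterNeighbors G Sigma.fst j} : Finset (Σ t, N t)).card ≤ d2 G := by
  classical
  have hindep : (G.induce (earlierNeighbors G i)).IsIndepSet
      (Y.subtype (· ∈ earlierNeighbors G i) : Set (earlierNeighbors G i)) :=
    fun x hx y hy hne => hY (Finset.mem_subtype.1 hx) (Finset.mem_subtype.1 hy)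
      (Subtype.coe_injective.ne hne)
  calc _ = (Y.subtype (· ∈ earlierNeighbors G i)).card := by
        rw [Finset.card_subtype]
        congr! 2 with j
        rw [mem_laterNeighbors, G.adj_comm]
        rfl
    _ ≤ (G.induce (earlierNeighbors G i)).indepNum := hindep.card_le_indepNum
    _ ≤ d2 G := Finset.le_sup (f := fun i => (G.induce (earlierNeighbors G i)).indepNum)
        (Finset.mem_univ i)

/-- The allocation of the optimal online policy for the valuations `u`, when the valuations are
expected to be `v t k` with probability `p t k`. -/
noncomputable def optimalAlloc (M : Matroid (Σ t, N t)) (G : SimpleGraph (Σ t, N t))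
    (p : Fin T → Fin K → ℝ) (v : ∀ t, Fin K → SetValuation (N t)) (u : ∀ t, SetValuation (N t))
    (t : Fin T) : Finset (N t) :=
  agentPart t (greedySet (JointlyIndep M G) (fun s => {i | i.1 = s})
    (onlineValue M G Sigma.fst p fun s k S => v s k (agentPart s S))
    (fun s S => u s (agentPart s S)) t)

variable (M : Matroid (Σ t, N t)) (G : SimpleGraph (Σ t, N t)) (p : Fin T → Fin K → ℝ)
  (v : ∀ t, Fin K → SetValuation (N t))

theorem allocated_optimalAlloc (u : ∀ t, SetValuation (N t)) :
    allocated (optimalAlloc M G p v u) = greedyState (JointlyIndep M G) (fun s => {i | i.1 = s})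
      (onlineValue M G Sigma.fst p fun s k S => v s k (agentPart s S))
      (fun s S => u s (agentPart s S)) (Fin.last T) := by
  ext i
  rw [mem_greedyState, allocated, Finset.mem_sigma, optimalAlloc, mem_agentPart]
  refine ⟨fun hi => ⟨i.1, Fin.castSucc_lt_last _, hi.2⟩, fun ⟨t, _, hi⟩ => ⟨Finset.mem_univ _, ?_⟩⟩
  obtain rfl : i.1 = t := (Finset.mem_filter.1 (optimalSet_subset hi)).2
  exact hi

/-- The online algorithm that follows an optimal policy of the dynamic program `onlineValue`. -/
noncomputable def optimalAlgorithm : OnlineAlgorithm M G where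
  alloc := optimalAlloc M G p v
  feasible u := by
    rw [Feasible, allocated_optimalAlloc]
    exact admissible_greedyState _ _ _ (jointlyIndep_empty M G) _ _
  nonanticipating u u' t h := by
    rw [optimalAlloc, optimalAlloc, greedySet_congr _ _ _ t fun s hs => by rw [h s hs]]

theorem expectedWelfare_optimalAlgorithm (hp1 : ∀ t, ∑ k, p t k = 1) :
    expectedWelfare (optimalAlgorithm M G p v) p v =
      onlineValue M G Sigma.fst p (fun t k S => v t k (agentPart t S)) 0 ∅ :=
  sum_prod_mul_sum_greedySet (JointlyIndep M G) (fun t => {i | i.1 = t}) hp1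
    fun t k S => v t k (agentPart t S)

variable {M G p v}

theorem prophetWelfare_le_onlineValue (hv : ∀ t k, 0 < p t k → IsXOS (v t k))
    {q : (Fin T → Fin K) → ℝ} (hq : IsCoupling p q) :
    prophetWelfare M G v q / ((d1 M + 1) * (d2 G + 1)) ≤
      onlineValue M G Sigma.fst p (fun t k S => v t k (agentPart t S)) 0 ∅ := by
  classical
  choose Y hY hmax using fun k => exists_welfare_eq_maxWelfare M G (profile v k)
  have hsupport : ∀ k t, ∃ c : N t → ℝ, 0 < q k →
      (∀ S, ∑ a ∈ S, c a ≤ v t (k t) S) ∧ ∑ a ∈ Y k t, c a = v t (k t) (Y k t) := fun k t => by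
    by_cases hk : 0 < q k
    · exact ((hv t (k t) (hq.pos_marginal hk t)).exists_support (Y k t)).imp fun c h _ => h
    · exact ⟨0, fun h => absurd h hk⟩
  choose c hc using hsupport
  have hprophet : prophetWelfare M G v q =
      ∑ k, q k * ∑ i ∈ allocated (Y k), c k i.1 i.2 := Finset.sum_congr rfl fun k _ => by
    rcases (hq.nonneg k).eq_or_lt with h0 | hk
    · simp [← h0]
    · rw [← hmax, allocated, Finset.sum_sigma]
      exact congrArg _ (Finset.sum_congr rfl fun t _ => (hc k t hk).2.symm)
  rw [hprophet]
  refine le_onlineValue (R := fun k => allocated (Y k)) (w := fun k i => c k i.1 i.2)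
    (r := fun t k S => v t k (agentPart t S)) hq hY
    (fun k i => card_filter_laterNeighbors_le_d2 (hY k).2 i) fun k hk t S hS => ?_
  rw [← sum_agentPart hS]
  exact (hc k t hk).1 (agentPart t S)

end AgentAllocation

theorem theorem2 {T K : ℕ} {N : Fin T → Type*} [∀ t, Fintype (N t)]
    (M : Matroid (Σ t, N t)) (hM : M.E = Set.univ) (G : SimpleGraph (Σ t, N t))
    (p : Fin T → Fin K → ℝ) (hp0 : ∀ t k, 0 ≤ p t k) (hp1 : ∀ t, ∑ k, p t k = 1)
    (v : ∀ t, Fin K → SetValuation (N t)) (hv : ∀ t k, 0 < p t k → IsXOS (v t k)) :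
    ∃ A : OnlineAlgorithm M G,
      1 / (((d1 M : ℝ) + 1) * ((d2 G : ℝ) + 1)) * OPT M G p v ≤ expectedWelfare A p v := by
  classical
  refine ⟨optimalAlgorithm M G p v, ?_⟩
  rw [expectedWelfare_optimalAlgorithm M G p v hp1, one_div, inv_mul_le_iff₀ (by positivity)]
  refine csSup_le ⟨_, _, isCoupling_prod p hp0 hp1, rfl⟩ ?_
  rintro _ ⟨q, hq, rfl⟩
  rw [← div_le_iff₀' (by positivity)]
  exact prophetWelfare_le_onlineValue hv hq
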